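/- There exists an absolute constant $C^*>0$ such that the following holds. Let $X$ be an integer random variable with $\mathbf P(X\ge -1)=1$ and $\mathbf E X\le 0$ (in particular $\mathbf E|X|<\infty$), and let $(S_t)_{t\ge 0}$ be a random walk with i.i.d. steps distributed as $X$; write $\mathbf P_u$ for the probability measure under which $S_0=u$, $u\in\mathbb Z$. Let $\sigma=\min\{t\ge 0: S_t\le 0\}$ and $H(\sigma)=\sum_{0\le t<\sigma} 1/S_t$. For each integer $\ell\ge 0$ let $\tau_\ell=\min\{t\ge 0: S_t\notin[2^{\ell-1},2^{\ell+2})\}$ and $$n_\ell=\min\Big\{t\in\mathbb N:\ \sup_{x\in\mathbb Z\cap[2^{\ell-1},2^{\ell+2})}\mathbf P_x(\tau_\ell\ge t)\le \tfrac12\Big\},$$ with $\min\emptyset=\infty$ throughout. Fix $\alpha\in(1,2]$ and let $M=\sup_{\ell\ge 0} n_\ell/2^{\alpha\ell}\in[0,\infty]$. Then for every real $v\ge 1$, $$\mathbf P_1\Big(H(\sigma)>\frac{C^*M}{\alpha-1}\cdot v\cdot \sigma^{(\alpha-1)/\alpha}\Big)\le e^{-v^\alpha}.$$ -/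

import Mathlib

open MeasureTheory
open scoped ENNReal

/-- The path `S₀ = u`, `Sₙ = u + x₀ + ⋯ + xₙ₋₁` with starting point `u` and steps `x₀, x₁, …`. -/
def walkPath (u : ℤ) (x : ℕ → ℤ) (n : ℕ) : ℤ :=
  u + ∑ i ∈ Finset.range n, x i

theorem measurable_walkPath (u : ℤ) : Measurable (walkPath u) := by
  unfold walkPath
  refine measurable_pi_lambda _ fun n => ?_
  exact measurable_const.add (Finset.measurable_sum _ fun i _ => measurable_pi_apply i)

/-- `ℙ_u`: the law, on the space of paths `ℕ → ℤ`, of the random walk started at `u` whose steps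
are independent with common law `ν`. -/
noncomputable def walkLaw (ν : Measure ℤ) (u : ℤ) : Measure (ℕ → ℤ) :=
  (Measure.infinitePi (fun _ : ℕ => ν)).map (walkPath u)

instance walkLaw_isProbabilityMeasure (ν : Measure ℤ) [IsProbabilityMeasure ν] (u : ℤ) :
    IsProbabilityMeasure (walkLaw ν u) :=
  Measure.isProbabilityMeasure_map (measurable_walkPath u).aemeasurable

/-- The first time `t` at which the path `s` is outside the set `A` (`∞` if there is none). -/
noncomputable def exitTime (A : Set ℤ) (s : ℕ → ℤ) : ℕ∞ :=
  ⨅ (t : ℕ) (_ : s t ∉ A), (t : ℕ∞)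

/-- `σ = min {t : S_t ≤ 0}`, with `σ = ∞` if the path never visits the non-positive integers. -/
noncomputable def hitTime (s : ℕ → ℤ) : ℕ∞ :=
  exitTime {z | 0 < z} s

/-- `H(σ) = ∑_{t < σ} 1 / S_t`. Every `S_t` occurring in this sum is a positive integer. -/
noncomputable def inverseSum (s : ℕ → ℤ) : ℝ≥0∞ :=
  ∑' t : ℕ, if (t : ℕ∞) < hitTime s then ENNReal.ofReal (1 / (s t : ℝ)) else 0

/-- The integer points of `[2^(ℓ-1), 2^(ℓ+2))`; for `ℓ = 0` the interval is `[1/2, 4)`. -/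
def scaleInterval (ℓ : ℕ) : Set ℤ :=
  {z | (2 : ℝ) ^ ((ℓ : ℤ) - 1) ≤ (z : ℝ) ∧ (z : ℝ) < (2 : ℝ) ^ (ℓ + 2)}

/-- `n_ℓ`: the least `t ∈ ℕ` for which `ℙ_x (τ ≥ t) ≤ 1/2` for the supremum over starting points
`x` in `[2^(ℓ-1), 2^(ℓ+2))`, where `τ` is the exit time from this interval; `∞` if there is no such
`t`. -/
noncomputable def scaleTime (ν : Measure ℤ) (ℓ : ℕ) : ℕ∞ :=
  ⨅ (t : ℕ) (_ : (⨆ x ∈ scaleInterval ℓ,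
    walkLaw ν x {s | (t : ℕ∞) ≤ exitTime (scaleInterval ℓ) s}) ≤ 1 / 2), (t : ℕ∞)

/-- `M(α) = sup_{ℓ ≥ 0} n_ℓ / 2^(α ℓ) ∈ [0, ∞]`. -/
noncomputable def scaleSup (ν : Measure ℤ) (α : ℝ) : ℝ≥0∞ :=
  ⨆ ℓ : ℕ, (scaleTime ν ℓ : ℝ≥0∞) / (2 : ℝ≥0∞) ^ (α * (ℓ : ℝ))

/-! Put β = α − 1. Since steps are at least −1 and the drift is nonpositive, `ramp R` is
superharmonic on the positive integers (`lintegral_ramp_le`). Two estimates follow. From 1, level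
2^ℓ is reached before absorption with probability at most 2^(-ℓ) (`walkLaw_reach_le`). And if n
steps suffice to leave [R/2, 4R) with probability at least 1/2 from every point, then a walk in [R,
2R) has, after 2n steps, a chance bounded below of never returning there, so its expected total time
there is at most 16n (`green_indicator_le`).

Weighting scale ℓ by 2^(-ℓ) and summing, the part of H(σ) from values below 2^(L+1) has expectation
of order M 2^(βL) / β from any start; the factor 1/β comes from a geometric series. Khasminskii's
lemma turns this uniform bound into an exponential tail (`walkLaw_le_pathSum_le`).

If σ = N, values above N^(1/α)/v contribute at most v N^(β/α) to H(σ), so a large H(σ) comes from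
lower values. Measured at the highest dyadic scale ℓ visited below this cutoff, the truncated sum is
at least 8 v^α in normalised units (`exists_scale_of_lt_sum`). A union bound over ℓ, using the
geometric mean of the reaching and tail probabilities, concludes. -/

/-! ### Path space and the Markov property. -/

/-- The path with initial value `x` followed by the path `s`. -/
def pathCons (x : ℤ) (s : ℕ → ℤ) : ℕ → ℤ
  | 0 => x
  | n + 1 => s n

@[simp] theorem pathCons_zero (x : ℤ) (s : ℕ → ℤ) : pathCons x s 0 = x := rfl

@[simp] theorem pathCons_succ (x : ℤ) (s : ℕ → ℤ) (n : ℕ) : pathCons x s (n + 1) = s n := rfl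

theorem measurable_pathCons : Measurable fun p : ℤ × (ℕ → ℤ) => pathCons p.1 p.2 := by
  refine measurable_pi_lambda _ fun n => ?_
  cases n with
  | zero => exact measurable_fst
  | succ n => exact (measurable_pi_apply n).comp measurable_snd

theorem walkPath_pathCons (u y : ℤ) (x : ℕ → ℤ) :
    walkPath u (pathCons y x) = pathCons u (walkPath (u + y) x) := by
  funext n
  cases n with
  | zero => simp [walkPath]
  | succ n =>
    simp only [walkPath, pathCons_succ, Finset.sum_range_succ', pathCons_zero]
    ring

theorem map_pathCons_infinitePi (ν : Measure ℤ) [IsProbabilityMeasure ν] :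
    (ν.prod (Measure.infinitePi fun _ : ℕ => ν)).map (fun p => pathCons p.1 p.2) =
      Measure.infinitePi fun _ : ℕ => ν := by
  refine Measure.eq_infinitePi _ fun s t ht => ?_
  obtain ⟨N, hN⟩ := s.exists_nat_subset_range
  -- Unconstrained coordinates are padded with `Set.univ`, so the box lives on an initial segment
  -- and its 0th coordinate splits off.
  set t' : ℕ → Set ℤ := fun i => if i ∈ s then t i else Set.univ with ht'
  have hsub : s ⊆ Finset.range (N + 1) :=
    hN.trans (Finset.range_mono (Nat.le_succ N))
  have hpre : (fun p : ℤ × (ℕ → ℤ) => pathCons p.1 p.2) ⁻¹' Set.pi s t =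
      t' 0 ×ˢ Set.pi (Finset.range N) fun i => t' (i + 1) := by
    ext ⟨y, x⟩
    simp only [Set.mem_preimage, Set.mem_pi, Finset.mem_coe, Set.mem_prod, Finset.mem_range, ht']
    constructor
    · intro h
      refine ⟨?_, fun i _ => ?_⟩
      · split_ifs with h0
        · exact h 0 h0
        · trivial
      · split_ifs with h0
        · exact h (i + 1) h0
        · trivial
    · rintro ⟨h0, h1⟩ i hi
      cases i with
      | zero => simpa [hi] using h0
      | succ i =>
        have := h1 i (by have := hsub hi; simp at this; omega)
        simpa [hi] using this
  rw [Measure.map_apply measurable_pathCons (MeasurableSet.pi (Set.to_countable _) fun i _ => ht i),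
    hpre, Measure.prod_prod, Measure.infinitePi_pi _ (fun i _ => MeasurableSet.of_discrete)]
  have : ∏ i ∈ s, ν (t i) = ∏ i ∈ Finset.range (N + 1), ν (t' i) := by
    refine Finset.prod_subset_one_on_sdiff hsub (fun i hi => ?_) fun i hi => ?_
    · simp only [Finset.mem_sdiff] at hi
      simp [ht', hi.2]
    · simp [ht', hi]
  rw [this, Finset.prod_range_succ', mul_comm]

/-- The Markov property of the random walk at time one. -/
theorem lintegral_walkLaw (ν : Measure ℤ) [IsProbabilityMeasure ν] (u : ℤ)
    {F : (ℕ → ℤ) → ℝ≥0∞} (hF : Measurable F) :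
    ∫⁻ s, F s ∂walkLaw ν u = ∫⁻ y, ∫⁻ s, F (pathCons u s) ∂walkLaw ν (u + y) ∂ν := by
  rw [walkLaw, lintegral_map hF (measurable_walkPath u)]
  conv_lhs => rw [← map_pathCons_infinitePi ν]
  have hG : Measurable fun x => F (walkPath u x) := hF.comp (measurable_walkPath u)
  rw [lintegral_map hG measurable_pathCons]
  refine (lintegral_prod _ (hG.comp measurable_pathCons).aemeasurable).trans
    (lintegral_congr fun y => ?_)
  have hFc : Measurable fun s => F (pathCons u s) :=
    hF.comp (measurable_pathCons.comp (measurable_const.prodMk measurable_id))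
  rw [walkLaw, lintegral_map hFc (measurable_walkPath _)]
  simp only [Function.comp_def, walkPath_pathCons]

/-- The Markov property of the random walk at time one, for probabilities. -/
theorem walkLaw_apply (ν : Measure ℤ) [IsProbabilityMeasure ν] (u : ℤ)
    {E : Set (ℕ → ℤ)} (hE : MeasurableSet E) :
    walkLaw ν u E = ∫⁻ y, walkLaw ν (u + y) (pathCons u ⁻¹' E) ∂ν := by
  have hc : Measurable (pathCons u) :=
    measurable_pathCons.comp (measurable_const.prodMk measurable_id)
  rw [← lintegral_indicator_one hE, lintegral_walkLaw ν u (measurable_one.indicator hE)]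
  refine lintegral_congr fun y => ?_
  rw [← lintegral_indicator_one (hc hE)]
  rfl

/-! ### The superharmonic ramp. -/

/-- The truncated ramp `z ↦ min (z⁺ / R) 1`. -/
noncomputable def ramp (R : ℝ) (z : ℤ) : ℝ≥0∞ :=
  min (ENNReal.ofReal (z / R)) 1

theorem ramp_le_one (R : ℝ) (z : ℤ) : ramp R z ≤ 1 := min_le_right _ _

theorem ramp_eq_one {R : ℝ} (hR : 0 < R) {z : ℤ} (hz : R ≤ z) : ramp R z = 1 := by
  refine min_eq_right ?_
  rw [← ENNReal.ofReal_one]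
  exact ENNReal.ofReal_le_ofReal ((one_le_div hR).2 hz)

theorem ramp_le {R : ℝ} (hR : 0 < R) {z : ℤ} {c : ℝ} (hz : (z : ℝ) ≤ c * R) :
    ramp R z ≤ ENNReal.ofReal c :=
  (min_le_left _ _).trans (ENNReal.ofReal_le_ofReal ((div_le_iff₀ hR).2 hz))

/-- For a left-continuous walk with nonpositive drift, the ramp is superharmonic on the positive
integers. -/
theorem lintegral_ramp_le {ν : Measure ℤ} [IsProbabilityMeasure ν] (h1 : ∀ᵐ x ∂ν, -1 ≤ x)
    (hi : Integrable (fun x : ℤ => (x : ℝ)) ν) (h0 : ∫ x : ℤ, (x : ℝ) ∂ν ≤ 0)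
    {R : ℝ} (hR : 0 < R) {x : ℤ} (hx : 0 < x) :
    ∫⁻ y, ramp R (x + y) ∂ν ≤ ramp R x := by
  refine le_min ?_ ?_
  · calc ∫⁻ y, ramp R (x + y) ∂ν ≤ ∫⁻ y, ENNReal.ofReal (((x + y : ℤ) : ℝ) / R) ∂ν :=
          lintegral_mono fun y => min_le_left _ _
      _ = ENNReal.ofReal (∫ y, ((x + y : ℤ) : ℝ) / R ∂ν) := by
          refine (ofReal_integral_eq_lintegral_ofReal ?_ ?_).symm
          · push_cast
            exact ((integrable_const _).add hi).div_const _
          -- Left-continuity enters here: from x ≥ 1 one step stays nonnegative, so the positive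
          -- part costs nothing and the drift bound applies.
          · filter_upwards [h1] with y hy
            have : (0 : ℤ) ≤ x + y := by omega
            exact div_nonneg (by exact_mod_cast this) hR.le
      _ ≤ ENNReal.ofReal (x / R) := by
          refine ENNReal.ofReal_le_ofReal ?_
          push_cast
          rw [integral_div, integral_add (integrable_const _) hi]
          simp only [integral_const, probReal_univ, smul_eq_mul, one_mul]
          gcongr
          linarith
  · calc ∫⁻ y, ramp R (x + y) ∂ν ≤ ∫⁻ _, 1 ∂ν := lintegral_mono fun y => ramp_le_one _ _
      _ = 1 := by simp

/-! ### Exit times and survival in a set. -/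

theorem natCast_le_exitTime {A : Set ℤ} {s : ℕ → ℤ} {m : ℕ} :
    (m : ℕ∞) ≤ exitTime A s ↔ ∀ t < m, s t ∈ A := by
  simp only [exitTime, le_iInf_iff, Nat.cast_le]
  exact forall_congr' fun t => by rw [← not_lt, not_imp_not]

theorem natCast_lt_exitTime {A : Set ℤ} {s : ℕ → ℤ} {m : ℕ} :
    (m : ℕ∞) < exitTime A s ↔ ∀ t ≤ m, s t ∈ A := by
  rw [← ENat.add_one_le_iff (ENat.natCast_ne_top m)]
  exact_mod_cast (natCast_le_exitTime (A := A) (s := s) (m := m + 1)).trans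
    (forall_congr' fun t => by rw [Nat.lt_succ_iff])

theorem natCast_lt_hitTime {s : ℕ → ℤ} {m : ℕ} :
    (m : ℕ∞) < hitTime s ↔ ∀ t ≤ m, 0 < s t :=
  natCast_lt_exitTime

theorem forall_lt_succ_pathCons {p : ℤ → Prop} {x : ℤ} {s : ℕ → ℤ} {m : ℕ} :
    (∀ t < m + 1, p (pathCons x s t)) ↔ p x ∧ ∀ t < m, p (s t) := by
  refine ⟨fun h => ⟨h 0 (Nat.succ_pos m), fun t ht => h (t + 1) (Nat.succ_lt_succ ht)⟩, ?_⟩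
  rintro ⟨h0, h⟩ t ht
  cases t with
  | zero => exact h0
  | succ t => exact h t (Nat.lt_of_succ_lt_succ ht)

theorem forall_le_succ_pathCons {p : ℤ → Prop} {x : ℤ} {s : ℕ → ℤ} {m : ℕ} :
    (∀ t ≤ m + 1, p (pathCons x s t)) ↔ p x ∧ ∀ t ≤ m, p (s t) := by
  simpa only [Nat.lt_succ_iff] using
    forall_lt_succ_pathCons (p := p) (x := x) (s := s) (m := m + 1)

/-- The probability that the walk started at `x` is in `J` at all times before `m`. -/
noncomputable def survival (ν : Measure ℤ) (J : Set ℤ) (m : ℕ) (x : ℤ) : ℝ≥0∞ :=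
  walkLaw ν x {s | ∀ t < m, s t ∈ J}

section survival

variable {ν : Measure ℤ} [IsProbabilityMeasure ν] {J : Set ℤ}

theorem measurableSet_forall_lt_mem (J : Set ℤ) (m : ℕ) :
    MeasurableSet {s : ℕ → ℤ | ∀ t < m, s t ∈ J} := by
  simp only [Set.ofPred_forall]
  exact .iInter fun t => .iInter fun _ => measurable_pi_apply t (MeasurableSet.of_discrete (s := J))

theorem survival_zero (x : ℤ) : survival ν J 0 x = 1 := by
  simp [survival]

theorem survival_succ_of_mem (m : ℕ) {x : ℤ} (hx : x ∈ J) :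
    survival ν J (m + 1) x = ∫⁻ y, survival ν J m (x + y) ∂ν := by
  rw [survival, walkLaw_apply ν x (measurableSet_forall_lt_mem J (m + 1))]
  refine lintegral_congr fun y => ?_
  rw [survival, Set.preimage_ofPred_eq]
  simp only [forall_lt_succ_pathCons (p := (· ∈ J)), hx, true_and]

theorem survival_succ_of_notMem (m : ℕ) {x : ℤ} (hx : x ∉ J) :
    survival ν J (m + 1) x = 0 := by
  rw [survival, walkLaw_apply ν x (measurableSet_forall_lt_mem J (m + 1))]
  simp only [Set.preimage_ofPred_eq, forall_lt_succ_pathCons (p := (· ∈ J)), hx, false_and,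
    Set.ofPred_false, measure_empty, lintegral_zero]

theorem survival_add_le {m : ℕ} {c : ℝ≥0∞} (hc : ∀ x, survival ν J m x ≤ c) (k : ℕ) (x : ℤ) :
    survival ν J (m + k) x ≤ c * survival ν J k x := by
  induction k generalizing x with
  | zero => simpa [survival_zero] using hc x
  | succ k ih =>
    rw [← add_assoc]
    by_cases hx : x ∈ J
    · rw [survival_succ_of_mem _ hx, survival_succ_of_mem _ hx,
        ← lintegral_const_mul _ (measurable_of_countable _)]
      exact lintegral_mono fun y => ih _
    · rw [survival_succ_of_notMem _ hx]
      exact zero_le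

theorem survival_two_mul_le {m : ℕ} {c : ℝ≥0∞} (hm : m ≠ 0) (hc : ∀ x ∈ J, survival ν J m x ≤ c)
    (x : ℤ) : survival ν J (2 * m) x ≤ c * c := by
  have h : ∀ x, survival ν J m x ≤ c := fun x => by
    by_cases hx : x ∈ J
    · exact hc x hx
    · obtain ⟨k, rfl⟩ := Nat.exists_eq_succ_of_ne_zero hm
      exact (survival_succ_of_notMem k hx).trans_le zero_le
  rw [two_mul]
  exact (survival_add_le h m x).trans (mul_le_mul_right (h x) c)

end survival

/-! ### Killed transition operator and potentials. -/

/-- The `m`-step transition operator of the walk killed at the nonpositive integers. -/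
noncomputable def killedStep (ν : Measure ℤ) (g : ℤ → ℝ≥0∞) : ℕ → ℤ → ℝ≥0∞
  | 0, x => g x
  | m + 1, x => if 0 < x then ∫⁻ y, killedStep ν g m (x + y) ∂ν else 0

/-- The potential `𝔼_x ∑_{t < N ∧ σ} f (S_t)` of the walk killed at the nonpositive integers. -/
noncomputable def green (ν : Measure ℤ) (f : ℤ → ℝ≥0∞) : ℕ → ℤ → ℝ≥0∞
  | 0, _ => 0
  | N + 1, x => if 0 < x then f x + ∫⁻ y, green ν f N (x + y) ∂ν else 0

section green

variable {ν : Measure ℤ}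

theorem killedStep_le_self {g : ℤ → ℝ≥0∞} (hg : ∀ x, 0 < x → ∫⁻ y, g (x + y) ∂ν ≤ g x)
    (m : ℕ) (x : ℤ) : killedStep ν g m x ≤ g x := by
  induction m generalizing x with
  | zero => exact le_rfl
  | succ m ih =>
    rw [killedStep]
    split_ifs with hx
    · exact (lintegral_mono fun y => ih _).trans (hg x hx)
    · exact zero_le

theorem green_le_succ (f : ℤ → ℝ≥0∞) (N : ℕ) (x : ℤ) : green ν f N x ≤ green ν f (N + 1) x := by
  induction N generalizing x with
  | zero => exact zero_le
  | succ N ih =>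
    rw [green, green]
    split_ifs with hx
    · gcongr
      exact ih _
    · exact le_rfl

theorem green_mono_time (f : ℤ → ℝ≥0∞) (x : ℤ) : Monotone fun N => green ν f N x :=
  monotone_nat_of_le_succ fun N => green_le_succ f N x

theorem green_mono {f g : ℤ → ℝ≥0∞} (h : ∀ x, f x ≤ g x) (N : ℕ) (x : ℤ) :
    green ν f N x ≤ green ν g N x := by
  induction N generalizing x with
  | zero => exact le_rfl
  | succ N ih =>
    rw [green, green]
    split_ifs with hx
    · gcongr
      · exact h x
      · exact ih _
    · exact le_rfl

theorem green_sum_mul {ι : Type*} (s : Finset ι) (c : ι → ℝ≥0∞) (f : ι → ℤ → ℝ≥0∞) (N : ℕ)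
    (x : ℤ) :
    green ν (fun z => ∑ i ∈ s, c i * f i z) N x = ∑ i ∈ s, c i * green ν (f i) N x := by
  induction N generalizing x with
  | zero => simp [green]
  | succ N ih =>
    simp only [green, ih]
    split_ifs with hx
    · rw [lintegral_finsetSum _ fun i _ => measurable_of_countable _, ← Finset.sum_add_distrib]
      refine Finset.sum_congr rfl fun i _ => ?_
      rw [lintegral_const_mul _ (measurable_of_countable _), mul_add]
    · simp

theorem green_le_natCast [IsProbabilityMeasure ν] {f : ℤ → ℝ≥0∞} (hf : ∀ x, f x ≤ 1) (N : ℕ)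
    (x : ℤ) : green ν f N x ≤ N := by
  induction N generalizing x with
  | zero => exact zero_le
  | succ N ih =>
    rw [green]
    split_ifs with hx
    · calc f x + ∫⁻ y, green ν f N (x + y) ∂ν ≤ 1 + ∫⁻ _, (N : ℝ≥0∞) ∂ν := by
            gcongr
            · exact hf x
            · exact ih _
        _ = ((N + 1 : ℕ) : ℝ≥0∞) := by simp [add_comm]
    · exact zero_le

/-- The maximum principle for the potential of a set. -/
theorem green_indicator_le_mul {I : Set ℤ} {φ : ℤ → ℝ≥0∞}
    (hφ : ∀ x, 0 < x → ∫⁻ y, φ (x + y) ∂ν ≤ φ x) (hI : ∀ x ∈ I, 1 ≤ φ x) {N : ℕ} {G : ℝ≥0∞}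
    (hG : ∀ x ∈ I, green ν (I.indicator 1) N x ≤ G) {K : ℕ} (hK : K ≤ N) (x : ℤ) :
    green ν (I.indicator 1) K x ≤ G * φ x := by
  induction K generalizing x with
  | zero => exact zero_le
  | succ K ih =>
    by_cases hx : x ∈ I
    · calc _ ≤ green ν (I.indicator 1) N x := green_mono_time _ x hK
        _ ≤ G := hG x hx
        _ = G * 1 := (mul_one G).symm
        _ ≤ G * φ x := by gcongr; exact hI x hx
    · rw [green]
      split_ifs with h0
      · rw [Set.indicator_of_notMem hx, zero_add]
        calc _ ≤ ∫⁻ y, G * φ (x + y) ∂ν := lintegral_mono fun y => ih (by omega) _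
          _ = G * ∫⁻ y, φ (x + y) ∂ν := lintegral_const_mul _ (measurable_of_countable _)
          _ ≤ G * φ x := by gcongr; exact hφ x h0
      · exact zero_le

/-- Split at time m: each of the first m steps costs at most 1, and what remains is bounded by the a
priori estimate at the position after m steps. -/
theorem green_le_add_killedStep [IsProbabilityMeasure ν] {f φ : ℤ → ℝ≥0∞} (hf : ∀ x, f x ≤ 1)
    {N : ℕ} {G : ℝ≥0∞} (h : ∀ K ≤ N, ∀ x, green ν f K x ≤ G * φ x) (m : ℕ) {K : ℕ} (hK : K ≤ N)
    (x : ℤ) : green ν f K x ≤ m + G * killedStep ν φ m x := by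
  induction m generalizing K x with
  | zero => simpa [killedStep] using h K hK x
  | succ m ih =>
    cases K with
    | zero => exact zero_le
    | succ K =>
      rw [green, killedStep]
      split_ifs with hx
      · calc _ ≤ 1 + ∫⁻ y, (m + G * killedStep ν φ m (x + y)) ∂ν := by
              gcongr
              · exact hf x
              · exact ih (by omega) _
          _ = _ := by
              rw [lintegral_add_left measurable_const,
                lintegral_const_mul _ (measurable_of_countable _)]
              simp only [lintegral_const, measure_univ, mul_one]
              push_cast
              ring
      · exact zero_le

end green

/-! ### Expected time spent at one scale. -/

section scale

variable {ν : Measure ℤ} [IsProbabilityMeasure ν] {R : ℝ} {J : Set ℤ}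

/-- Optional stopping at the exit from J. After a downward exit the ramp has mean at most 1/2; an
upward exit is charged to `ramp (4 * R)`, which is superharmonic; staying in J for m steps is
charged to the survival probability. Each of the last two costs at most a further 1/2. -/
theorem killedStep_ramp_le (h1 : ∀ᵐ x ∂ν, -1 ≤ x)
    (hi : Integrable (fun x : ℤ => (x : ℝ)) ν) (h0 : ∫ x : ℤ, (x : ℝ) ∂ν ≤ 0)
    (hR : 0 < R) (hJ : ∀ z : ℤ, z ∈ J ↔ R / 2 ≤ z ∧ z < 4 * R) (m : ℕ) (x : ℤ) :
    killedStep ν (ramp R) m x ≤ 2⁻¹ + 2⁻¹ * ramp (4 * R) x + 2⁻¹ * survival ν J m x := by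
  have h4R : 0 < 4 * R := by positivity
  induction m generalizing x with
  | zero =>
    rw [killedStep, survival_zero, mul_one, add_right_comm, ENNReal.inv_two_add_inv_two]
    exact (ramp_le_one R x).trans le_self_add
  | succ m ih =>
    by_cases hx : 0 < x
    · by_cases hxJ : x ∈ J
      · rw [killedStep, if_pos hx, survival_succ_of_mem _ hxJ]
        calc _ ≤ ∫⁻ y, (2⁻¹ + 2⁻¹ * ramp (4 * R) (x + y) + 2⁻¹ * survival ν J m (x + y)) ∂ν :=
              lintegral_mono fun y => ih _
          _ = 2⁻¹ + 2⁻¹ * ∫⁻ y, ramp (4 * R) (x + y) ∂ν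
                + 2⁻¹ * ∫⁻ y, survival ν J m (x + y) ∂ν := by
              rw [lintegral_add_left (measurable_of_countable _),
                lintegral_add_left measurable_const,
                lintegral_const_mul _ (measurable_of_countable _),
                lintegral_const_mul _ (measurable_of_countable _)]
              simp
          _ ≤ _ := by
              gcongr
              exact lintegral_ramp_le h1 hi h0 h4R hx
      · refine (killedStep_le_self (fun x hx => lintegral_ramp_le h1 hi h0 hR hx) _ x).trans ?_
        refine le_trans ?_ le_self_add
        by_cases hlt : (x : ℝ) < R / 2
        · refine le_trans ?_ le_self_add
          refine (ramp_le hR (c := 2⁻¹) (by linarith)).trans_eq ?_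
          rw [ENNReal.ofReal_inv_of_pos two_pos, ENNReal.ofReal_ofNat]
        · rw [ramp_eq_one h4R (z := x) (by
            by_contra hc
            exact hxJ ((hJ x).2 ⟨not_lt.1 hlt, not_le.1 hc⟩)), mul_one,
            ENNReal.inv_two_add_inv_two]
          exact ramp_le_one R x
    · rw [killedStep, if_neg hx]
      exact zero_le

/-- The expected time spent at scale `R` before absorption is at most a constant times the
time scale of the exit from an enlarged window. -/
theorem green_indicator_le (h1 : ∀ᵐ x ∂ν, -1 ≤ x)
    (hi : Integrable (fun x : ℤ => (x : ℝ)) ν) (h0 : ∫ x : ℤ, (x : ℝ) ∂ν ≤ 0)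
    (hR : 0 < R) (hJ : ∀ z : ℤ, z ∈ J ↔ R / 2 ≤ z ∧ z < 4 * R) {I : Set ℤ}
    (hI : ∀ z : ℤ, z ∈ I ↔ R ≤ z ∧ z < 2 * R) {n : ℕ}
    (hn : ∀ x ∈ J, survival ν J n x ≤ 2⁻¹) (N : ℕ) (x : ℤ) :
    green ν (I.indicator 1) N x ≤ ENNReal.ofReal (16 * n) := by
  have hf : ∀ x, I.indicator (1 : ℤ → ℝ≥0∞) x ≤ 1 := fun x =>
    Set.indicator_le_self' (fun _ _ => zero_le) x
  have hφ : ∀ x : ℤ, 0 < x → ∫⁻ y, ramp R (x + y) ∂ν ≤ ramp R x := fun x hx =>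
    lintegral_ramp_le h1 hi h0 hR hx
  -- 7/8 = 1/2 + 1/4 + 1/8: `ramp (4 * R)` is at most 1/2 below 2R, and two blocks of n steps bring
  -- survival to 1/4. A single block would only give the useless bound 1.
  have hstep : ∀ z ∈ I, killedStep ν (ramp R) (2 * n) z ≤ ENNReal.ofReal (7 / 8) := by
    intro z hz
    have hz' := (hI z).1 hz
    have hzJ : z ∈ J := (hJ z).2 ⟨by linarith, by linarith⟩
    have hn0 : n ≠ 0 := by
      rintro rfl
      have := hn z hzJ
      rw [survival_zero] at this
      exact absurd this (not_le.2 (ENNReal.inv_lt_one.2 ENNReal.one_lt_two))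
    have e2 : (2⁻¹ : ℝ≥0∞) = ENNReal.ofReal 2⁻¹ := by
      rw [ENNReal.ofReal_inv_of_pos two_pos, ENNReal.ofReal_ofNat]
    calc _ ≤ 2⁻¹ + 2⁻¹ * ramp (4 * R) z + 2⁻¹ * survival ν J (2 * n) z :=
          killedStep_ramp_le h1 hi h0 hR hJ _ _
      _ ≤ 2⁻¹ + 2⁻¹ * 2⁻¹ + 2⁻¹ * (2⁻¹ * 2⁻¹) := by
          gcongr
          · rw [e2]
            exact ramp_le (by positivity) (by linarith)
          · exact survival_two_mul_le hn0 hn z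
      _ = ENNReal.ofReal (7 / 8) := by
          simp only [e2]
          rw [← ENNReal.ofReal_mul (by norm_num), ← ENNReal.ofReal_mul (by norm_num),
            ← ENNReal.ofReal_add (by norm_num) (by norm_num),
            ← ENNReal.ofReal_add (by norm_num) (by norm_num)]
          norm_num
  set G : ℝ≥0∞ := ⨆ z ∈ I, green ν (I.indicator 1) N z with hGdef
  have hG : ∀ z ∈ I, green ν (I.indicator 1) N z ≤ G := fun z hz =>
    le_iSup₂ (f := fun z (_ : z ∈ I) => green ν (I.indicator 1) N z) z hz
  -- Truncation at time N makes G finite a priori, so that G ≤ 2n + 7G/8 can be solved to give G ≤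
  -- 16n.
  have hGtop : G ≠ ∞ := ne_top_of_le_ne_top (ENNReal.natCast_ne_top N)
    (iSup₂_le fun z _ => green_le_natCast hf N z)
  have hmax : ∀ K ≤ N, ∀ z, green ν (I.indicator 1) K z ≤ G * ramp R z := fun K hK z =>
    green_indicator_le_mul hφ (fun w hw => (ramp_eq_one hR ((hI w).1 hw).1).ge) hG hK z
  have hGle : G ≤ (2 * n : ℕ) + G * ENNReal.ofReal (7 / 8) := by
    refine iSup₂_le fun z hz => ?_
    refine (green_le_add_killedStep hf hmax (2 * n) le_rfl z).trans ?_
    gcongr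
    exact hstep z hz
  obtain ⟨g, hg0, hg⟩ : ∃ g : ℝ, 0 ≤ g ∧ G = ENNReal.ofReal g :=
    ⟨G.toReal, ENNReal.toReal_nonneg, (ENNReal.ofReal_toReal hGtop).symm⟩
  have hg16 : g ≤ 16 * n := by
    rw [hg, ← ENNReal.ofReal_mul hg0, ← ENNReal.ofReal_natCast,
      ← ENNReal.ofReal_add (by positivity) (by positivity),
      ENNReal.ofReal_le_ofReal_iff (by positivity)] at hGle
    push_cast at hGle
    linarith
  calc _ ≤ G * ramp R x := hmax N le_rfl x
    _ ≤ G * 1 := by gcongr; exact ramp_le_one R x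
    _ ≤ _ := by rw [mul_one, hg]; exact ENNReal.ofReal_le_ofReal hg16

end scale

/-! ### Exponential moments and reaching probabilities. -/

/-- The additive functional `∑_{t < N ∧ σ} F (S_t)`. -/
noncomputable def pathSum (F : ℤ → ℝ) (N : ℕ) (s : ℕ → ℤ) : ℝ :=
  open Classical in ∑ t ∈ Finset.range N, if ∀ i ≤ t, 0 < s i then F (s t) else 0

theorem measurableSet_forall_le_pos (t : ℕ) : MeasurableSet {s : ℕ → ℤ | ∀ i ≤ t, 0 < s i} := by
  simpa only [Nat.lt_succ_iff, Set.mem_ofPred_eq] using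
    measurableSet_forall_lt_mem {z : ℤ | 0 < z} (t + 1)

theorem measurable_pathSum (F : ℤ → ℝ) (N : ℕ) : Measurable (pathSum F N) := by
  unfold pathSum
  exact Finset.measurable_sum _ fun t _ => Measurable.ite (measurableSet_forall_le_pos t)
    ((measurable_of_countable F).comp (measurable_pi_apply t)) measurable_const

theorem pathSum_succ_pathCons (F : ℤ → ℝ) (N : ℕ) (x : ℤ) (s : ℕ → ℤ) :
    pathSum F (N + 1) (pathCons x s) = if 0 < x then F x + pathSum F N s else 0 := by
  simp only [pathSum, Finset.sum_range_succ', forall_le_succ_pathCons (p := fun z => 0 < z),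
    pathCons_succ, pathCons_zero, Nat.le_zero, forall_eq]
  split_ifs with hx
  · simp [hx, add_comm]
  · simp [hx]

theorem pathSum_mono_time {F : ℤ → ℝ} (hF : ∀ x, 0 ≤ F x) (s : ℕ → ℤ) :
    Monotone fun N => pathSum F N s := by
  refine monotone_nat_of_le_succ fun N => ?_
  simp only [pathSum, Finset.sum_range_succ]
  refine le_add_of_nonneg_right ?_
  split_ifs
  · exact hF _
  · exact le_rfl

/-- Induction step of Khasminskii's lemma, with a the present reward and b the expected future one.
It reduces to (1 − a)(1 + 2(a + b)) ≥ 1 + 2b, where the difference is a(1 − 2(a + b)). -/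
theorem Real.exp_mul_one_add_le {a b : ℝ} (ha : 0 ≤ a) (hb : 0 ≤ b) (hab : a + b ≤ 1 / 2) :
    Real.exp a * (1 + 2 * b) ≤ 1 + 2 * (a + b) := by
  have h1 : 1 - a ≤ Real.exp (-a) := Real.one_sub_le_exp_neg a
  have h2 : 1 + 2 * b ≤ Real.exp (-a) * (1 + 2 * (a + b)) := by
    have : (1 - a) * (1 + 2 * (a + b)) ≤ Real.exp (-a) * (1 + 2 * (a + b)) := by gcongr
    nlinarith
  calc Real.exp a * (1 + 2 * b) ≤ Real.exp a * (Real.exp (-a) * (1 + 2 * (a + b))) := by gcongr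
    _ = 1 + 2 * (a + b) := by
      rw [← mul_assoc, ← Real.exp_add, add_neg_cancel, Real.exp_zero, one_mul]

theorem ENNReal.ofReal_exp_mul_one_add_le {a : ℝ} (ha : 0 ≤ a) {b : ℝ≥0∞}
    (hab : ENNReal.ofReal a + b ≤ 2⁻¹) :
    ENNReal.ofReal (Real.exp a) * (1 + 2 * b) ≤ 1 + 2 * (ENNReal.ofReal a + b) := by
  have e2 : (2⁻¹ : ℝ≥0∞) = ENNReal.ofReal (1 / 2) := by
    rw [one_div, ENNReal.ofReal_inv_of_pos two_pos, ENNReal.ofReal_ofNat]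
  have hb : b ≠ ∞ := ne_top_of_le_ne_top (by simp) (le_add_self.trans hab)
  obtain ⟨c, hc, rfl⟩ : ∃ c : ℝ, 0 ≤ c ∧ b = ENNReal.ofReal c :=
    ⟨b.toReal, ENNReal.toReal_nonneg, (ENNReal.ofReal_toReal hb).symm⟩
  rw [e2, ← ENNReal.ofReal_add ha hc, ENNReal.ofReal_le_ofReal_iff (by norm_num)] at hab
  rw [← ENNReal.ofReal_add ha hc, ← ENNReal.ofReal_one, ← ENNReal.ofReal_ofNat 2,
    ← ENNReal.ofReal_mul (by norm_num), ← ENNReal.ofReal_mul (by norm_num),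
    ← ENNReal.ofReal_add (by norm_num) (by positivity),
    ← ENNReal.ofReal_add (by norm_num) (by positivity),
    ← ENNReal.ofReal_mul (Real.exp_pos a).le]
  exact ENNReal.ofReal_le_ofReal (Real.exp_mul_one_add_le ha hc hab)

section

variable {ν : Measure ℤ} [IsProbabilityMeasure ν]

/-- Khasminskii's lemma for the killed walk. -/
theorem lintegral_exp_pathSum_le {F : ℤ → ℝ} (hF : ∀ x, 0 ≤ F x)
    (hg : ∀ N x, green ν (fun z => ENNReal.ofReal (F z)) N x ≤ 2⁻¹) (N : ℕ) (x : ℤ) :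
    ∫⁻ s, ENNReal.ofReal (Real.exp (pathSum F N s)) ∂walkLaw ν x
      ≤ 1 + 2 * green ν (fun z => ENNReal.ofReal (F z)) N x := by
  have hm : ∀ N, Measurable fun s => ENNReal.ofReal (Real.exp (pathSum F N s)) := fun N =>
    (Real.measurable_exp.comp (measurable_pathSum F N)).ennreal_ofReal
  induction N generalizing x with
  | zero => simp [pathSum]
  | succ N ih =>
    have hgx := hg (N + 1) x
    rw [lintegral_walkLaw ν x (hm _)]
    simp only [pathSum_succ_pathCons]
    rw [green] at hgx ⊢
    split_ifs at hgx ⊢ with hx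
    · refine le_trans ?_ (ENNReal.ofReal_exp_mul_one_add_le (hF x) hgx)
      have h2 : (1 : ℝ≥0∞) + 2 * ∫⁻ y, green ν (fun z => ENNReal.ofReal (F z)) N (x + y) ∂ν =
          ∫⁻ y, (1 + 2 * green ν (fun z => ENNReal.ofReal (F z)) N (x + y)) ∂ν := by
        rw [lintegral_add_left measurable_const, lintegral_const_mul _ (measurable_of_countable _)]
        simp
      rw [h2, ← lintegral_const_mul _ (measurable_of_countable _)]
      refine lintegral_mono fun y => ?_
      simp only [Real.exp_add, ENNReal.ofReal_mul (Real.exp_pos _).le]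
      rw [lintegral_const_mul _ (hm N)]
      gcongr
      exact ih _
    · simp

/-- Markov's inequality for the exponential, whose mean is at most 2 uniformly in N; the events
increase with N, so the bound passes to their union. -/
theorem walkLaw_le_pathSum_le {F : ℤ → ℝ} (hF : ∀ x, 0 ≤ F x)
    (hg : ∀ N x, green ν (fun z => ENNReal.ofReal (F z)) N x ≤ 2⁻¹) (a : ℝ) (x : ℤ) :
    walkLaw ν x {s | ∃ N, a ≤ pathSum F N s} ≤ ENNReal.ofReal (2 * Real.exp (-a)) := by
  have hmono : Monotone fun N => {s | a ≤ pathSum F N s} := 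
    fun N K hNK s (hs : a ≤ pathSum F N s) => hs.trans (pathSum_mono_time hF s hNK)
  have hU : {s | ∃ N, a ≤ pathSum F N s} = ⋃ N, {s | a ≤ pathSum F N s} := by
    ext s
    simp
  rw [hU, hmono.measure_iUnion]
  refine iSup_le fun N => ?_
  have hmk := mul_meas_ge_le_lintegral (μ := walkLaw ν x)
    (Real.measurable_exp.comp (measurable_pathSum F N)).ennreal_ofReal
    (ENNReal.ofReal (Real.exp a))
  have hset : {s | ENNReal.ofReal (Real.exp a) ≤
      ENNReal.ofReal ((Real.exp ∘ pathSum F N) s)} = {s | a ≤ pathSum F N s} := by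
    ext s
    simp only [Set.mem_ofPred_eq, Function.comp_apply,
      ENNReal.ofReal_le_ofReal_iff (Real.exp_pos _).le, Real.exp_le_exp]
  rw [hset] at hmk
  have h2 : ∫⁻ s, ENNReal.ofReal (Real.exp (pathSum F N s)) ∂walkLaw ν x ≤ 2 := by
    refine (lintegral_exp_pathSum_le hF hg N x).trans ?_
    calc _ ≤ (1 : ℝ≥0∞) + 2 * 2⁻¹ := by gcongr; exact hg N x
      _ = 2 := by rw [ENNReal.mul_inv_cancel two_ne_zero ENNReal.ofNat_ne_top, one_add_one_eq_two]
  calc walkLaw ν x {s | a ≤ pathSum F N s}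
      = ENNReal.ofReal (Real.exp (-a)) *
          (ENNReal.ofReal (Real.exp a) * walkLaw ν x {s | a ≤ pathSum F N s}) := by
        rw [← mul_assoc, ← ENNReal.ofReal_mul (Real.exp_pos _).le, ← Real.exp_add,
          neg_add_cancel, Real.exp_zero, ENNReal.ofReal_one, one_mul]
    _ ≤ ENNReal.ofReal (Real.exp (-a)) * 2 := by
        gcongr
        exact hmk.trans h2
    _ = ENNReal.ofReal (2 * Real.exp (-a)) := by
        rw [ENNReal.ofReal_mul two_pos.le, ENNReal.ofReal_ofNat, mul_comm]

/-- The probability of reaching `[R, ∞)` before absorption. -/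
theorem walkLaw_reach_le (h1 : ∀ᵐ x ∂ν, -1 ≤ x)
    (hi : Integrable (fun x : ℤ => (x : ℝ)) ν) (h0 : ∫ x : ℤ, (x : ℝ) ∂ν ≤ 0)
    {R : ℝ} (hR : 0 < R) (x : ℤ) :
    walkLaw ν x {s | ∃ t, (∀ i ≤ t, 0 < s i) ∧ R ≤ s t} ≤ ramp R x := by
  set E : ℕ → Set (ℕ → ℤ) := fun N => {s | ∃ t < N, (∀ i ≤ t, 0 < s i) ∧ R ≤ s t} with hE
  have hmE : ∀ N, MeasurableSet (E N) := fun N => by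
    have : E N = ⋃ t, ⋃ (_ : t < N), {s : ℕ → ℤ | ∀ i ≤ t, 0 < s i} ∩ {s | R ≤ s t} := by
      ext s
      simp only [hE, Set.mem_ofPred_eq, Set.mem_iUnion, Set.mem_inter_iff, exists_prop]
    rw [this]
    exact .iUnion fun t => .iUnion fun _ => (measurableSet_forall_le_pos t).inter
      (measurableSet_le measurable_const
        ((measurable_of_countable fun z : ℤ => (z : ℝ)).comp (measurable_pi_apply t)))
  have hbound : ∀ N x, walkLaw ν x (E N) ≤ ramp R x := by
    intro N
    induction N with
    | zero => intro x; simp [hE]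
    | succ N ih =>
      intro x
      by_cases hxR : R ≤ x
      · rw [ramp_eq_one hR hxR]
        exact prob_le_one
      · have hsub : pathCons x ⁻¹' E (N + 1) ⊆ E N ∩ {_s | 0 < x} := by
          rintro s ⟨t, ht, hpos, hRt⟩
          cases t with
          | zero => exact absurd hRt hxR
          | succ t =>
            rw [forall_le_succ_pathCons (p := fun z => 0 < z)] at hpos
            exact ⟨⟨t, by omega, hpos.2, hRt⟩, hpos.1⟩
        rw [walkLaw_apply ν x (hmE _)]
        by_cases hx : 0 < x
        · exact (lintegral_mono fun y => (measure_mono (hsub.trans Set.inter_subset_left)).trans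
            (ih _)).trans (lintegral_ramp_le h1 hi h0 hR hx)
        · simp only [hx, Set.ofPred_false, Set.inter_empty, Set.subset_empty_iff] at hsub
          simp [hsub]
  have hU : {s : ℕ → ℤ | ∃ t, (∀ i ≤ t, 0 < s i) ∧ R ≤ s t} = ⋃ N, E N := by
    ext s
    simp only [hE, Set.mem_ofPred_eq, Set.mem_iUnion]
    exact ⟨fun ⟨t, h⟩ => ⟨t + 1, t, t.lt_succ_self, h⟩, fun ⟨_, t, _, h⟩ => ⟨t, h⟩⟩
  have hmono : Monotone E := fun N K hNK s ⟨t, ht, h⟩ => ⟨t, ht.trans_le hNK, h⟩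
  rw [hU, hmono.measure_iUnion]
  exact iSup_le fun N => hbound N x

end

/-! ### Dyadic decomposition of the truncated inverse. -/

/-- The function `z ↦ 1 / z` restricted to `(0, 2 ^ (L + 1))`. -/
noncomputable def lowInv (L : ℕ) (z : ℤ) : ℝ :=
  if 0 < z ∧ (z : ℝ) < 2 ^ (L + 1) then 1 / z else 0

theorem lowInv_nonneg (L : ℕ) (z : ℤ) : 0 ≤ lowInv L z := by
  unfold lowInv
  split_ifs with h
  · have : (0 : ℝ) < z := by exact_mod_cast h.1
    positivity
  · exact le_rfl

/-- The integer points of `[2 ^ ℓ, 2 ^ (ℓ + 1))`. -/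
def dyadicBlock (ℓ : ℕ) : Set ℤ := {z | (2 : ℝ) ^ ℓ ≤ z ∧ (z : ℝ) < 2 * 2 ^ ℓ}

theorem ofReal_mul_lowInv_le {c : ℝ} (hc : 0 ≤ c) (L : ℕ) (z : ℤ) :
    ENNReal.ofReal (c * lowInv L z) ≤ ∑ ℓ ∈ Finset.range (L + 1),
      ENNReal.ofReal (c / 2 ^ ℓ) * (dyadicBlock ℓ).indicator 1 z := by
  unfold lowInv
  split_ifs with h
  · have hz1 : (1 : ℝ) ≤ z := by exact_mod_cast h.1
    obtain ⟨ℓ, hℓ1, hℓ2⟩ := exists_nat_pow_near hz1 one_lt_two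
    have hℓ : ℓ < L + 1 := (pow_lt_pow_iff_right₀ (one_lt_two : (1 : ℝ) < 2)).1 (hℓ1.trans_lt h.2)
    have hmem : z ∈ dyadicBlock ℓ := ⟨hℓ1, by rwa [pow_succ'] at hℓ2⟩
    calc ENNReal.ofReal (c * (1 / z)) ≤ ENNReal.ofReal (c / 2 ^ ℓ) := by
          refine ENNReal.ofReal_le_ofReal ?_
          rw [mul_one_div]
          gcongr
      _ = ENNReal.ofReal (c / 2 ^ ℓ) * (dyadicBlock ℓ).indicator 1 z := by
          rw [Set.indicator_of_mem hmem, Pi.one_apply, mul_one]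
      _ ≤ _ := Finset.single_le_sum
          (f := fun ℓ => ENNReal.ofReal (c / 2 ^ ℓ) * (dyadicBlock ℓ).indicator 1 z)
          (fun _ _ => zero_le) (Finset.mem_range.2 hℓ)
  · simp

theorem mem_scaleInterval {ℓ : ℕ} {z : ℤ} :
    z ∈ scaleInterval ℓ ↔ (2 : ℝ) ^ ℓ / 2 ≤ z ∧ (z : ℝ) < 4 * 2 ^ ℓ := by
  rw [scaleInterval, Set.mem_ofPred_eq, zpow_sub_one₀ two_ne_zero, zpow_natCast, pow_add,
    ← div_eq_mul_inv, mul_comm (4 : ℝ)]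
  norm_num

/-- Source of the factor 1/(α − 1). Bernoulli's inequality for exponents in (0, 1] gives 2^(-β) ≤ 1
− β/2, hence q − 1 ≥ qβ/2, which is exactly the induction step. -/
theorem geom_sum_two_rpow_le {β : ℝ} (hβ : 0 < β) (hβ1 : β ≤ 1) (L : ℕ) :
    ∑ ℓ ∈ Finset.range (L + 1), ((2 : ℝ) ^ β) ^ ℓ ≤ 2 / β * ((2 : ℝ) ^ β) ^ L := by
  set q : ℝ := (2 : ℝ) ^ β with hq
  have hq0 : 0 < q := by positivity
  have hb : q⁻¹ ≤ 1 - β / 2 := by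
    have := rpow_one_add_le_one_add_mul_self (s := -1 / 2) (by norm_num) hβ.le hβ1
    rw [hq, ← Real.inv_rpow two_pos.le]
    norm_num at this ⊢
    linarith
  have hstep : 2 / β + q ≤ 2 / β * q := by
    have h1 : 1 ≤ (1 - β / 2) * q := by
      calc (1 : ℝ) = q⁻¹ * q := (inv_mul_cancel₀ hq0.ne').symm
        _ ≤ _ := by gcongr
    have : q ≤ 2 / β * (q - 1) := by
      rw [div_mul_eq_mul_div, le_div_iff₀ hβ]
      linarith
    linarith
  induction L with
  | zero =>
    simp only [zero_add, Finset.range_one, Finset.sum_singleton, pow_zero, mul_one]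
    rw [le_div_iff₀ hβ]
    linarith
  | succ L ih =>
    rw [Finset.sum_range_succ]
    have := mul_le_mul_of_nonneg_right hstep (pow_pos hq0 L).le
    rw [pow_succ]
    nlinarith

/-- The potential of `z ↦ 1 / z` below scale `2 ^ L`, normalised, is at most one half. -/
theorem green_lowInv_le {ν : Measure ℤ} [IsProbabilityMeasure ν] (h1 : ∀ᵐ x ∂ν, -1 ≤ x)
    (hi : Integrable (fun x : ℤ => (x : ℝ)) ν) (h0 : ∫ x : ℤ, (x : ℝ) ∂ν ≤ 0)
    {β M : ℝ} (hβ : 0 < β) (hβ1 : β ≤ 1) (hM : 0 < M) {n : ℕ → ℕ}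
    (hn : ∀ ℓ, ∀ x ∈ scaleInterval ℓ, survival ν (scaleInterval ℓ) (n ℓ) x ≤ 2⁻¹)
    (hnM : ∀ ℓ, (n ℓ : ℝ) ≤ M * (2 ^ ℓ * ((2 : ℝ) ^ β) ^ ℓ)) (L N : ℕ) (x : ℤ) :
    green ν (fun z => ENNReal.ofReal (β / (64 * M * ((2 : ℝ) ^ β) ^ L) * lowInv L z)) N x
      ≤ 2⁻¹ := by
  set q : ℝ := (2 : ℝ) ^ β with hq
  have hq0 : 0 < q := by positivity
  -- Chosen so that 16 · c · M · (2/β) · q^L = 1/2, the threshold in Khasminskii's lemma.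
  set c : ℝ := β / (64 * M * q ^ L) with hc
  have hc0 : 0 ≤ c := by positivity
  calc _ ≤ green ν (fun z => ∑ ℓ ∈ Finset.range (L + 1),
          ENNReal.ofReal (c / 2 ^ ℓ) * (dyadicBlock ℓ).indicator 1 z) N x :=
        green_mono (ofReal_mul_lowInv_le hc0 L) N x
    _ = ∑ ℓ ∈ Finset.range (L + 1),
          ENNReal.ofReal (c / 2 ^ ℓ) * green ν ((dyadicBlock ℓ).indicator 1) N x :=
        green_sum_mul _ _ (fun ℓ => (dyadicBlock ℓ).indicator 1) N x
    _ ≤ ∑ ℓ ∈ Finset.range (L + 1), ENNReal.ofReal (16 * c * M * q ^ ℓ) := by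
        refine Finset.sum_le_sum fun ℓ _ => ?_
        calc _ ≤ ENNReal.ofReal (c / 2 ^ ℓ) * ENNReal.ofReal (16 * n ℓ) := by
              gcongr
              exact green_indicator_le h1 hi h0 (by positivity) (fun z => mem_scaleInterval)
                (fun z => Iff.rfl) (hn ℓ) N x
          _ ≤ _ := by
              rw [← ENNReal.ofReal_mul (by positivity)]
              refine ENNReal.ofReal_le_ofReal ?_
              calc _ ≤ c / 2 ^ ℓ * (16 * (M * (2 ^ ℓ * q ^ ℓ))) := by gcongr; exact hnM ℓ
                _ = 16 * c * M * q ^ ℓ := by field_simp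
    _ = ENNReal.ofReal (16 * c * M * ∑ ℓ ∈ Finset.range (L + 1), q ^ ℓ) := by
        rw [Finset.mul_sum, ENNReal.ofReal_sum_of_nonneg fun ℓ _ => by positivity]
    _ ≤ ENNReal.ofReal 2⁻¹ := by
        refine ENNReal.ofReal_le_ofReal ?_
        calc _ ≤ 16 * c * M * (2 / β * q ^ L) := by
              gcongr
              exact geom_sum_two_rpow_le hβ hβ1 L
          _ = 2⁻¹ := by
              rw [hc]
              field_simp
              norm_num
    _ = 2⁻¹ := by rw [ENNReal.ofReal_inv_of_pos two_pos, ENNReal.ofReal_ofNat]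

/-! ### Pathwise analysis of a large inverse sum. -/

theorem pathSum_eq_sum (F : ℤ → ℝ) {N : ℕ} {s : ℕ → ℤ} (hs : ∀ t < N, 0 < s t) :
    pathSum F N s = ∑ t ∈ Finset.range N, F (s t) := by
  refine Finset.sum_congr rfl fun t ht => if_pos fun i hi => hs i ?_
  exact hi.trans_lt (Finset.mem_range.1 ht)

/-- Take the highest visited scale up to L: the dyadic blocks above it are empty, so lowering the
cutoff loses nothing. Scale 0 is always visited. Having ℓ visited is what makes the later union
bound summable. -/
theorem exists_reach_of_sum_lowInv {s : ℕ → ℤ} {N : ℕ} (hN : 0 < N) (hs : ∀ t < N, 0 < s t)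
    (L : ℕ) : ∃ ℓ, (∃ t < N, (2 : ℝ) ^ ℓ ≤ s t) ∧ ℓ ≤ L ∧
      ∑ t ∈ Finset.range N, lowInv L (s t) = ∑ t ∈ Finset.range N, lowInv ℓ (s t) := by
  induction L with
  | zero => exact ⟨0, ⟨0, hN, by rw [pow_zero]; exact_mod_cast hs 0 hN⟩, le_rfl, rfl⟩
  | succ L ih =>
    by_cases h : ∃ t < N, (2 : ℝ) ^ (L + 1) ≤ s t
    · exact ⟨L + 1, h, le_rfl, rfl⟩
    · obtain ⟨ℓ, h1, h2, h3⟩ := ih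
      refine ⟨ℓ, h1, h2.trans L.le_succ, h3 ▸ Finset.sum_congr rfl fun t ht => ?_⟩
      have hlt : (s t : ℝ) < 2 ^ (L + 1) := by
        by_contra hc
        exact h ⟨t, Finset.mem_range.1 ht, not_lt.1 hc⟩
      have hlt' : (s t : ℝ) < 2 ^ (L + 1 + 1) :=
        hlt.trans (pow_lt_pow_right₀ one_lt_two (Nat.lt_succ_self _))
      simp [lowInv, hlt, hlt']

theorem one_div_le_lowInv_add (L : ℕ) {z : ℤ} (hz : 0 < z) :
    1 / (z : ℝ) ≤ lowInv L z + 1 / 2 ^ (L + 1) := by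
  unfold lowInv
  by_cases h : (z : ℝ) < 2 ^ (L + 1)
  · rw [if_pos ⟨hz, h⟩]
    exact le_add_of_nonneg_right (by positivity)
  · rw [if_neg fun h' => h h'.2, zero_add]
    exact one_div_le_one_div_of_le (by positivity) (not_lt.1 h)

/-- If `∑ 1 / S_t` is large compared to the duration `N` of the excursion, then some truncated
sum up to a scale visited by the excursion is exceptionally large. -/
theorem exists_scale_of_lt_sum {s : ℕ → ℤ} {N : ℕ} (hN : 0 < N) (hs : ∀ t < N, 0 < s t)
    {α M v : ℝ} (hα : 1 < α) (hα2 : α ≤ 2) (hM : 1 ≤ M) (hv : 1 ≤ v)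
    (h : 1024 / (α - 1) * M * v * (N : ℝ) ^ ((α - 1) / α) < ∑ t ∈ Finset.range N, 1 / (s t : ℝ)) :
    ∃ ℓ, (∃ t < N, (2 : ℝ) ^ ℓ ≤ s t) ∧ 8 * v ^ α ≤
      (α - 1) / (64 * M * ((2 : ℝ) ^ (α - 1)) ^ ℓ) * ∑ t ∈ Finset.range N, lowInv ℓ (s t) := by
  set β : ℝ := α - 1 with hβdef
  have hβ : 0 < β := by linarith
  have hβ1 : β ≤ 1 := by linarith
  have hα0 : 0 < α := by linarith
  have hv0 : 0 < v := by linarith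
  have hM0 : 0 < M := by linarith
  have hNr : (0 : ℝ) < N := by exact_mod_cast hN
  set r : ℝ := (N : ℝ) ^ (1 / α) with hr
  have hr0 : 0 < r := by positivity
  have hrβ : (N : ℝ) ^ (β / α) = r ^ β := by
    rw [hr, ← Real.rpow_mul hNr.le]
    congr 1
    ring
  have hNe : (N : ℝ) = r * r ^ β := by
    rw [← hrβ, hr, ← Real.rpow_add hNr, ← add_div, hβdef, add_sub_cancel, div_self hα0.ne',
      Real.rpow_one]
  set q : ℝ := (2 : ℝ) ^ β with hq
  have hq1 : 1 ≤ q := Real.one_le_rpow one_le_two hβ.le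
  have hK : 1024 ≤ 1024 / β * M := by
    rw [div_mul_eq_mul_div, le_div_iff₀ hβ]
    nlinarith
  have hrβ0 : 0 < r ^ β := by positivity
  have hvr0 : 0 < v * r ^ β := by positivity
  rw [hrβ] at h
  -- Every term of the sum is at most 1, so the sum is at most N = r · r^β; this forces r/v > 1 and
  -- makes a dyadic cutoff near r/v available.
  have hvr : v < r := by
    have hle : ∑ t ∈ Finset.range N, 1 / (s t : ℝ) ≤ N := by
      calc _ ≤ ∑ t ∈ Finset.range N, (1 : ℝ) := by
            refine Finset.sum_le_sum fun t ht => ?_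
            have : (1 : ℝ) ≤ s t := by exact_mod_cast hs t (Finset.mem_range.1 ht)
            exact (div_le_one (by linarith)).2 this
        _ = N := by simp
    have : v * r ^ β < r * r ^ β := by
      calc v * r ^ β ≤ 1024 / β * M * (v * r ^ β) := le_mul_of_one_le_left hvr0.le (by linarith)
        _ = 1024 / β * M * v * r ^ β := by ring
        _ < _ := h.trans_le hle
        _ = _ := hNe
    exact lt_of_mul_lt_mul_right this hrβ0.le
  obtain ⟨L, hL1, hL2⟩ := exists_nat_pow_near ((one_le_div hv0).2 hvr.le) one_lt_two
  obtain ⟨ℓ, hreach, hℓL, hsum⟩ := exists_reach_of_sum_lowInv hN hs L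
  refine ⟨ℓ, hreach, ?_⟩
  have hsplit : ∑ t ∈ Finset.range N, 1 / (s t : ℝ) ≤
      ∑ t ∈ Finset.range N, lowInv L (s t) + v * r ^ β := by
    calc _ ≤ ∑ t ∈ Finset.range N, (lowInv L (s t) + 1 / 2 ^ (L + 1)) :=
          Finset.sum_le_sum fun t ht => one_div_le_lowInv_add L (hs t (Finset.mem_range.1 ht))
      _ = ∑ t ∈ Finset.range N, lowInv L (s t) + N / 2 ^ (L + 1) := by
          rw [Finset.sum_add_distrib]
          simp [div_eq_mul_inv]
      _ ≤ _ := by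
          gcongr
          rw [div_le_iff₀ (by positivity), hNe]
          have : r ≤ 2 ^ (L + 1) * v := ((div_lt_iff₀ hv0).1 hL2).le
          calc r * r ^ β ≤ 2 ^ (L + 1) * v * r ^ β := by gcongr
            _ = _ := by ring
  -- The values above the cutoff contribute at most v · r^β, less than half of the assumed lower
  -- bound.
  have hbig : 512 / β * M * v * r ^ β ≤ ∑ t ∈ Finset.range N, lowInv L (s t) := by
    have e : 1024 / β * M * v * r ^ β = 2 * (512 / β * M * v * r ^ β) := by ring
    have : v * r ^ β ≤ 512 / β * M * v * r ^ β := by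
      calc v * r ^ β ≤ 512 / β * M * (v * r ^ β) := by
            refine le_mul_of_one_le_left hvr0.le ?_
            have : 1024 / β * M = 2 * (512 / β * M) := by ring
            linarith
        _ = _ := by ring
    linarith
  have hrq : v ^ β * q ^ ℓ ≤ r ^ β := by
    calc v ^ β * q ^ ℓ ≤ v ^ β * q ^ L := by gcongr
      _ = (v * 2 ^ L) ^ β := by
          rw [Real.mul_rpow hv0.le (by positivity), hq, ← Real.rpow_natCast, ← Real.rpow_natCast,
            ← Real.rpow_mul two_pos.le, ← Real.rpow_mul two_pos.le, mul_comm β]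
      _ ≤ r ^ β := by
          gcongr
          rw [mul_comm]
          exact (le_div_iff₀ hv0).1 hL1
  have hvα : v ^ α = v * v ^ β := by
    rw [hβdef, ← Real.rpow_one_add' hv0.le (by linarith), add_sub_cancel]
  have hq0 : 0 < q := by linarith
  rw [← hsum]
  calc 8 * v ^ α = β / (64 * M * q ^ ℓ) * (512 / β * M * v * (v ^ β * q ^ ℓ)) := by
        rw [hvα]
        field_simp
        norm_num
    _ ≤ β / (64 * M * q ^ ℓ) * (512 / β * M * v * r ^ β) := by gcongr
    _ ≤ _ := by gcongr

/-- A path for which `H(σ)` exceeds the threshold has a finite excursion, of which some visited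
scale carries an exceptionally large truncated sum. -/
theorem exists_scale_of_lt_inverseSum {s : ℕ → ℤ} {α M v : ℝ} (hα : 1 < α) (hα2 : α ≤ 2)
    (hM : 1 ≤ M) (hv : 1 ≤ v)
    (h : ENNReal.ofReal (1024 / (α - 1)) * ENNReal.ofReal M * ENNReal.ofReal v *
      (hitTime s : ℝ≥0∞) ^ ((α - 1) / α) < inverseSum s) :
    ∃ ℓ, (∃ t, (∀ i ≤ t, 0 < s i) ∧ (2 : ℝ) ^ ℓ ≤ s t) ∧ ∃ N, 8 * v ^ α ≤
      pathSum (fun z => (α - 1) / (64 * M * ((2 : ℝ) ^ (α - 1)) ^ ℓ) * lowInv ℓ z) N s := by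
  have hβ : 0 < α - 1 := by linarith
  have hα0 : 0 < α := by linarith
  have hv0 : 0 < v := by linarith
  have hM0 : 0 < M := by linarith
  have hpos : 0 < (α - 1) / α := by positivity
  -- With σ infinite the threshold is infinite, so the strict inequality fails.
  have hne : hitTime s ≠ ⊤ := by
    intro htop
    rw [htop, ENat.toENNReal_top, ENNReal.top_rpow_of_pos hpos, ENNReal.mul_top] at h
    · exact not_top_lt h
    · simp only [ne_eq, mul_eq_zero, ENNReal.ofReal_eq_zero, not_or, not_le]
      exact ⟨⟨by positivity, hM0⟩, hv0⟩
  obtain ⟨N, hN⟩ := ENat.ne_top_iff_exists.1 hne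
  have hlt : ∀ t : ℕ, (t : ℕ∞) < hitTime s ↔ t < N := fun t => by rw [← hN, Nat.cast_lt]
  have hs : ∀ t < N, 0 < s t := fun t ht =>
    natCast_lt_hitTime.1 ((hlt t).2 ht) t le_rfl
  have hH : inverseSum s = ENNReal.ofReal (∑ t ∈ Finset.range N, 1 / (s t : ℝ)) := by
    rw [inverseSum, tsum_eq_sum (s := Finset.range N), ENNReal.ofReal_sum_of_nonneg]
    · refine Finset.sum_congr rfl fun t ht => ?_
      rw [if_pos ((hlt t).2 (Finset.mem_range.1 ht))]
    · intro t ht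
      have : (0 : ℝ) < s t := by exact_mod_cast hs t (Finset.mem_range.1 ht)
      positivity
    · intro t ht
      rw [if_neg (by rwa [hlt, ← Finset.mem_range])]
  have hN0 : 0 < N := by
    rcases Nat.eq_zero_or_pos N with rfl | h0
    · simp [hH] at h
    · exact h0
  rw [hH, ← hN, ENat.toENNReal_coe, ← ENNReal.ofReal_natCast,
    ENNReal.ofReal_rpow_of_nonneg (Nat.cast_nonneg N) hpos.le,
    ← ENNReal.ofReal_mul (by positivity), ← ENNReal.ofReal_mul (by positivity),
    ← ENNReal.ofReal_mul (by positivity)] at h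
  obtain ⟨ℓ, ⟨t, ht, hreach⟩, hℓ⟩ := exists_scale_of_lt_sum hN0 hs hα hα2 hM hv
    (ENNReal.ofReal_lt_ofReal_iff_of_nonneg (by positivity) |>.1 h)
  refine ⟨ℓ, ⟨t, fun i hi => hs i (hi.trans_lt ht), hreach⟩, N, ?_⟩
  rwa [pathSum_eq_sum _ hs, ← Finset.mul_sum]

/-! ### Bounds on M and choice of exit times. -/

/-- Time 0 never qualifies, since the constraint there holds with probability 1 > 1/2. This yields M
≥ 1. -/
theorem one_le_scaleTime_zero (ν : Measure ℤ) [IsProbabilityMeasure ν] : 1 ≤ scaleTime ν 0 := by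
  refine le_iInf₂ fun t ht => ?_
  rcases Nat.eq_zero_or_pos t with rfl | h0
  · exfalso
    have hmem : (1 : ℤ) ∈ scaleInterval 0 := mem_scaleInterval.2 (by norm_num)
    have := (le_iSup₂ (f := fun x (_ : x ∈ scaleInterval 0) =>
      walkLaw ν x {s | ((0 : ℕ) : ℕ∞) ≤ exitTime (scaleInterval 0) s}) 1 hmem).trans ht
    simp only [Nat.cast_zero, zero_le, Set.ofPred_true, measure_univ, one_div] at this
    exact absurd this (not_le.2 (ENNReal.inv_lt_one.2 ENNReal.one_lt_two))
  · exact_mod_cast h0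

theorem one_le_scaleSup (ν : Measure ℤ) [IsProbabilityMeasure ν] (α : ℝ) : 1 ≤ scaleSup ν α := by
  refine le_trans ?_ (le_iSup (fun ℓ : ℕ =>
    (scaleTime ν ℓ : ℝ≥0∞) / (2 : ℝ≥0∞) ^ (α * (ℓ : ℝ))) 0)
  simp only [Nat.cast_zero, mul_zero, ENNReal.rpow_zero, div_one]
  exact_mod_cast one_le_scaleTime_zero ν

theorem exists_survival_le_of_scaleSup (ν : Measure ℤ) {α M : ℝ} (hM : 0 ≤ M)
    (h : scaleSup ν α ≤ ENNReal.ofReal M) (ℓ : ℕ) :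
    ∃ n : ℕ, (∀ x ∈ scaleInterval ℓ, survival ν (scaleInterval ℓ) n x ≤ 2⁻¹) ∧
      (n : ℝ) ≤ M * (2 ^ ℓ * ((2 : ℝ) ^ (α - 1)) ^ ℓ) := by
  have e : (2 : ℝ≥0∞) ^ (α * (ℓ : ℝ)) = ENNReal.ofReal (2 ^ ℓ * ((2 : ℝ) ^ (α - 1)) ^ ℓ) := by
    rw [← ENNReal.ofReal_ofNat 2, ENNReal.ofReal_rpow_of_pos two_pos, Real.rpow_mul two_pos.le,
      Real.rpow_natCast, ← mul_pow]
    congr 2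
    rw [Real.rpow_sub_one two_ne_zero]
    ring
  have h1 : (scaleTime ν ℓ : ℝ≥0∞) ≤ ENNReal.ofReal (M * (2 ^ ℓ * ((2 : ℝ) ^ (α - 1)) ^ ℓ)) := by
    rw [ENNReal.ofReal_mul hM, ← e, ← ENNReal.div_le_iff (by simp) (by simp)]
    exact (le_iSup (fun ℓ : ℕ =>
      (scaleTime ν ℓ : ℝ≥0∞) / (2 : ℝ≥0∞) ^ (α * (ℓ : ℝ))) ℓ).trans h
  have hne : scaleTime ν ℓ ≠ ⊤ := by
    intro htop
    rw [htop, ENat.toENNReal_top, top_le_iff] at h1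
    exact ENNReal.ofReal_ne_top h1
  obtain ⟨m, hm⟩ := ENat.ne_top_iff_exists.1 hne
  have hlt : scaleTime ν ℓ < ((m + 1 : ℕ) : ℕ∞) := by
    rw [← hm, Nat.cast_lt]
    exact m.lt_succ_self
  obtain ⟨n, hn⟩ := iInf_lt_iff.1 hlt
  obtain ⟨hsup, hnm⟩ := iInf_lt_iff.1 hn
  refine ⟨n, fun x hx => ?_, ?_⟩
  · have := (le_iSup₂ (f := fun x (_ : x ∈ scaleInterval ℓ) =>
      walkLaw ν x {s | (n : ℕ∞) ≤ exitTime (scaleInterval ℓ) s}) x hx).trans hsup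
    simpa only [survival, natCast_le_exitTime, one_div] using this
  · have hnm' : n ≤ m := by
      rw [Nat.cast_lt] at hnm
      omega
    rw [← hm, ENat.toENNReal_coe, ← ENNReal.ofReal_natCast,
      ENNReal.ofReal_le_ofReal_iff (by positivity)] at h1
    exact le_trans (by exact_mod_cast hnm') h1

/-! ### Union bound over scales. -/

/-- The minimum is at most the geometric mean: this lets a joint probability keep decay from both
events without independence. -/
theorem le_mul_of_le_sq {p : ℝ≥0∞} {a b : ℝ} (ha : 0 ≤ a) (hb : 0 ≤ b)
    (hpa : p ≤ ENNReal.ofReal (a ^ 2)) (hpb : p ≤ ENNReal.ofReal (b ^ 2)) :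
    p ≤ ENNReal.ofReal (a * b) := by
  rcases le_total a b with hab | hab
  · refine hpa.trans (ENNReal.ofReal_le_ofReal ?_)
    rw [sq]
    gcongr
  · refine hpb.trans (ENNReal.ofReal_le_ofReal ?_)
    rw [sq]
    gcongr

theorem theorem4p3 :
    ∃ C : ℝ, 0 < C ∧
      ∀ (ν : Measure ℤ) [IsProbabilityMeasure ν],
        (∀ᵐ x ∂ν, -1 ≤ x) →
        Integrable (fun x : ℤ => (x : ℝ)) ν →
        ∫ x : ℤ, (x : ℝ) ∂ν ≤ 0 →
        ∀ α : ℝ, 1 < α → α ≤ 2 →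
        ∀ v : ℝ, 1 ≤ v →
          walkLaw ν 1 {s | ENNReal.ofReal (C / (α - 1)) * scaleSup ν α * ENNReal.ofReal v *
              (hitTime s : ℝ≥0∞) ^ ((α - 1) / α) < inverseSum s}
            ≤ ENNReal.ofReal (Real.exp (-v ^ α)) := by
  refine ⟨1024, by norm_num, fun ν _ h1 hi h0 α hα hα2 v hv => ?_⟩
  have hβ : 0 < α - 1 := by linarith
  have hv0 : 0 < v := by linarith
  rcases eq_or_ne (scaleSup ν α) ∞ with htop | hfin
  · have hempty : {s | ENNReal.ofReal (1024 / (α - 1)) * scaleSup ν α * ENNReal.ofReal v *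
        (hitTime s : ℝ≥0∞) ^ ((α - 1) / α) < inverseSum s} = ∅ := by
      ext s
      simp only [Set.mem_ofPred_eq, Set.mem_empty_iff_false, iff_false, htop]
      intro h
      have hpos : 0 < (α - 1) / α := by
        have : 0 < α := by linarith
        positivity
      -- When σ = 0 the convention ∞ · 0 = 0 makes the threshold 0, but H(σ) = 0 as well.
      rcases eq_or_ne (hitTime s) 0 with hz | hz
      · simp [inverseSum, hz] at h
      · have hz' : (hitTime s : ℝ≥0∞) ^ ((α - 1) / α) ≠ 0 := by
          rw [ne_eq, ENNReal.rpow_eq_zero_iff_of_pos hpos, ENat.toENNReal_eq_zero]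
          exact hz
        have hC : (0 : ℝ) < 1024 / (α - 1) := by positivity
        rw [ENNReal.mul_top (by simpa using hC),
          ENNReal.top_mul (by simpa using hv0), ENNReal.top_mul hz'] at h
        exact not_top_lt h
    rw [hempty, measure_empty]
    exact zero_le
  set M : ℝ := (scaleSup ν α).toReal with hMdef
  have hMs : scaleSup ν α = ENNReal.ofReal M := (ENNReal.ofReal_toReal hfin).symm
  have hM : 1 ≤ M := by
    have := one_le_scaleSup ν α
    rwa [hMs, ENNReal.one_le_ofReal] at this
  have hM0 : 0 < M := by linarith
  choose n hn hnM using exists_survival_le_of_scaleSup ν hM0.le hMs.le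
  set F : ℕ → ℤ → ℝ := fun ℓ z =>
    (α - 1) / (64 * M * ((2 : ℝ) ^ (α - 1)) ^ ℓ) * lowInv ℓ z with hF
  set A : ℕ → Set (ℕ → ℤ) := fun ℓ => {s | ∃ t, (∀ i ≤ t, 0 < s i) ∧ (2 : ℝ) ^ ℓ ≤ s t} with hA
  set B : ℕ → Set (ℕ → ℤ) := fun ℓ => {s | ∃ N, 8 * v ^ α ≤ pathSum (F ℓ) N s} with hB
  set w : ℝ := v ^ α with hw
  have hw1 : 1 ≤ w := Real.one_le_rpow hv (by linarith)
  -- 1/2 is relaxed to 9/16 to have the rational square root 3/4, whose geometric series sums to 4.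
  have hpA : ∀ ℓ, walkLaw ν 1 (A ℓ) ≤ ENNReal.ofReal (((3 / 4 : ℝ) ^ ℓ) ^ 2) := fun ℓ => by
    refine ((walkLaw_reach_le h1 hi h0 (by positivity) 1).trans
      (ramp_le (by positivity) (c := (1 / 2) ^ ℓ) ?_)).trans (ENNReal.ofReal_le_ofReal ?_)
    · rw [← mul_pow]
      norm_num
    · rw [← pow_mul, mul_comm, pow_mul]
      exact pow_le_pow_left₀ (by norm_num) (by norm_num) ℓ
  -- The square root halves the exponent 8w to 4w; the spare exp(−3w) absorbs the final constant 8,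
  -- as w ≥ 1.
  have hpB : ∀ ℓ, walkLaw ν 1 (B ℓ) ≤ ENNReal.ofReal ((2 * Real.exp (-(4 * w))) ^ 2) := fun ℓ => by
    refine (walkLaw_le_pathSum_le (fun z => ?_)
      (green_lowInv_le h1 hi h0 hβ (by linarith) hM0 hn hnM ℓ) _ 1).trans
      (ENNReal.ofReal_le_ofReal ?_)
    · exact mul_nonneg (by positivity) (lowInv_nonneg ℓ z)
    · have : Real.exp (-(8 * w)) = Real.exp (-(4 * w)) ^ 2 := by
        rw [← Real.exp_nat_mul]
        congr 1
        push_cast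
        ring
      rw [this, mul_pow]
      nlinarith [sq_nonneg (Real.exp (-(4 * w)))]
  calc _ ≤ walkLaw ν 1 (⋃ ℓ, A ℓ ∩ B ℓ) := by
        refine measure_mono fun s hs => ?_
        rw [Set.mem_ofPred_eq, hMs] at hs
        obtain ⟨ℓ, hℓ⟩ := exists_scale_of_lt_inverseSum hα hα2 hM hv hs
        exact Set.mem_iUnion.2 ⟨ℓ, hℓ⟩
    _ ≤ ∑' ℓ, walkLaw ν 1 (A ℓ ∩ B ℓ) := measure_iUnion_le _
    _ ≤ ∑' ℓ : ℕ, ENNReal.ofReal (2 * Real.exp (-(4 * w)) * (3 / 4) ^ ℓ) :=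
        ENNReal.tsum_le_tsum fun ℓ => le_mul_of_le_sq (by positivity) (by positivity)
          ((measure_mono Set.inter_subset_right).trans (hpB ℓ))
          ((measure_mono Set.inter_subset_left).trans (hpA ℓ))
    _ = ENNReal.ofReal (8 * Real.exp (-(4 * w))) := by
        rw [← ENNReal.ofReal_tsum_of_nonneg (fun ℓ => by positivity)
          ((summable_geometric_of_lt_one (by norm_num) (by norm_num)).mul_left _), tsum_mul_left,
          tsum_geometric_of_lt_one (by norm_num) (by norm_num)]
        congr 1
        ring
    _ ≤ ENNReal.ofReal (Real.exp (-w)) := by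
        refine ENNReal.ofReal_le_ofReal ?_
        have h8 : (8 : ℝ) ≤ Real.exp (3 * w) := by
          have h2 : (2 : ℝ) ≤ Real.exp w := by linarith [Real.add_one_le_exp w]
          calc (8 : ℝ) = 2 ^ 3 := by norm_num
            _ ≤ Real.exp w ^ 3 := by gcongr
            _ = Real.exp (3 * w) := by rw [← Real.exp_nat_mul]; norm_num
        calc 8 * Real.exp (-(4 * w)) ≤ Real.exp (3 * w) * Real.exp (-(4 * w)) := by gcongr
          _ = Real.exp (-w) := by
            rw [← Real.exp_add]
            congr 1
            ring
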